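/- Let $R$ be a commutative ring, $n\ge 4$, $N=\binom n2$. Index the rows and columns of matrices in $\mathrm{GL}_N(R)$ by the two-element subsets $I=\{i_1<i_2\}$ of $\{1,\dots,n\}$, and let $\bigwedge^2:\mathrm{GL}_n(R)\to\mathrm{GL}_N(R)$ be the homomorphism sending a matrix to the matrix of its second order minors. Let $\bigwedge^2\mathrm{GL}_n(R)$ be the group of $R$-points of the (scheme-theoretic) image of the group scheme $\mathrm{GL}_n$ over $\mathbb Z$ under $\bigwedge^2:\mathrm{GL}_n\to\mathrm{GL}_N$; it contains the image of $\mathrm{GL}_n(R)$, in general properly. Let $t_{k,l}(\xi)=e+\xi e_{k,l}$ $(k\ne l)$ be the elementary transvections, let $E_n(R)\le \mathrm{GL}_n(R)$ be the subgroup that they generate, and let $\bigwedge^2E_n(R)$ be its image under $\bigwedge^2$. For $g\in\bigwedge^2\mathrm{GL}_n(R)$ the upper level $\mathrm{lev}(g)$ is the smallest ideal $A$ of $R$ such that the reduction of $g$ modulo $A$ lies in the center of $\bigwedge^2\mathrm{GL}_n(R/A)$. An elementary conjugate of $g$ or $g^{-1}$ is a matrix $h^{-1}g^{\pm1}h$ with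 $h\in\bigwedge^2E_n(R)$. Let $g\in\bigwedge^2\mathrm{GL}_n(R)$ and $1\le k\ne l\le n$. Then for every $\xi\in\mathrm{lev}(g)$ the exterior transvection $\bigwedge^2t_{k,l}(\xi)$ is a product of at most $8(N^2-1)$ elementary conjugates of $g$ and $g^{-1}$. Moreover, for all two-element subsets $I,J$ of $\{1,\dots,n\}$: 1. if $|I\cap J|=1$, then $\bigwedge^2t_{k,l}(g_{I,J})$ is a product of $8$ elementary conjugates of $g$ and $g^{-1}$; 2. if $|I\cap J|=0$, then $\bigwedge^2t_{k,l}(g_{I,J})$ is a product of $16$ elementary conjugates of $g$ and $g^{-1}$; 3. if $|I\cap J|=1$, then $\bigwedge^2t_{k,l}(g_{I,I}-g_{J,J})$ is a product of $24$ elementary conjugates of $g$ and $g^{-1}$; 4. if $|I\cap J|=0$, then $\bigwedge^2t_{k,l}(g_{I,I}-g_{J,J})$ is a product of $48$ elementary conjugates of $g$ and $g^{-1}$. -/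

import Mathlib

namespace ExtSq

/-- The index set of the bivector representation: two-element subsets of `[n]`, recorded as
pairs in ascending order. Its cardinality is `n.choose 2`. -/
abbrev Pair (n : ℕ) : Type := {p : Fin n × Fin n // p.1 < p.2}

/-- The height of a pair of indices: the cardinality of the intersection. -/
def height {n : ℕ} (I J : Pair n) : ℕ :=
  (({I.1.1, I.1.2} : Finset (Fin n)) ∩ {J.1.1, J.1.2}).card

section Minors

variable {n : ℕ} {R : Type*} [CommRing R]

/-- The matrix of second order minors of `x`: the row index is the pair of rows, the column index
is the pair of columns. -/
def minors (x : Matrix (Fin n) (Fin n) R) : Matrix (Pair n) (Pair n) R :=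
  Matrix.of fun I J => x I.1.1 J.1.1 * x I.1.2 J.1.2 - x I.1.1 J.1.2 * x I.1.2 J.1.1

theorem minors_one : minors (1 : Matrix (Fin n) (Fin n) R) = 1 := by
  ext ⟨⟨a, b⟩, hab⟩ ⟨⟨c, d⟩, hcd⟩
  simp only [minors, Matrix.of_apply, Matrix.one_apply, Subtype.mk.injEq, Prod.mk.injEq]
  simp only at hab hcd
  by_cases h1 : a = c <;> by_cases h2 : b = d <;> by_cases h3 : a = d <;> by_cases h4 : b = c <;>
    simp [h1, h2, h3, h4] <;> subst_vars <;> omega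

/-- A sum over all ordered pairs splits into the contributions of ascending pairs, if the diagonal
terms vanish. -/
theorem sum_pair (f : Fin n → Fin n → R) (h0 : ∀ a, f a a = 0) :
    ∑ a, ∑ b, f a b = ∑ K : Pair n, (f K.1.1 K.1.2 + f K.1.2 K.1.1) := by
  have h1 : ∀ F : Fin n → Fin n → R, ∑ K : Pair n, F K.1.1 K.1.2 =
      ∑ a, ∑ b, if a < b then F a b else 0 := by
    intro F
    rw [← Fintype.sum_prod_type', ← Finset.sum_filter]
    exact (Finset.sum_subtype (Finset.univ.filter fun p : Fin n × Fin n => p.1 < p.2)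
      (by simp) (fun p => F p.1 p.2)).symm
  rw [h1 (fun a b => f a b + f b a)]
  have h2 : ∀ a b, (if a < b then f a b + f b a else 0) =
      (if a < b then f a b else 0) + (if a < b then f b a else 0) := by
    intro a b; split_ifs <;> simp
  simp only [h2, Finset.sum_add_distrib]
  rw [Finset.sum_comm (f := fun a b => if a < b then f b a else 0)]
  simp only [← Finset.sum_add_distrib]
  refine Finset.sum_congr rfl fun a _ => Finset.sum_congr rfl fun b _ => ?_
  rcases lt_trichotomy a b with h | h | h
  · simp [h, h.not_gt]
  · subst h; simp [h0]
  · simp [h, h.not_gt]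

/-- The Cauchy–Binet formula for second order minors. -/
theorem minors_mul (x y : Matrix (Fin n) (Fin n) R) : minors (x * y) = minors x * minors y := by
  ext I J
  have h := sum_pair (fun a b => x I.1.1 a * x I.1.2 b *
    (y a J.1.1 * y b J.1.2 - y a J.1.2 * y b J.1.1)) (fun a => by ring)
  have h' : minors (x * y) I J = ∑ a, ∑ b, x I.1.1 a * x I.1.2 b *
      (y a J.1.1 * y b J.1.2 - y a J.1.2 * y b J.1.1) := by
    simp only [minors, Matrix.of_apply, Matrix.mul_apply, Finset.sum_mul_sum,
      ← Finset.sum_sub_distrib]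
    exact Finset.sum_congr rfl fun a _ => Finset.sum_congr rfl fun b _ => by ring
  rw [h', h, Matrix.mul_apply]
  refine Finset.sum_congr rfl fun K _ => ?_
  simp only [minors, Matrix.of_apply]
  ring

/-- The Cauchy–Binet homomorphism `⋀² : GL_n(R) → GL_N(R)`, `N = n.choose 2`. -/
def extSq : Matrix.GeneralLinearGroup (Fin n) R →* Matrix.GeneralLinearGroup (Pair n) R :=
  Units.map
    { toFun := minors
      map_one' := minors_one
      map_mul' := minors_mul }

/-- The elementary transvection `t_{i,j}(ξ) = e + ξ e_{i,j}`, `i ≠ j`, as an element of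
`GL_n(R)`. -/
def transv (i j : Fin n) (hij : i ≠ j) (ξ : R) : Matrix.GeneralLinearGroup (Fin n) R where
  val := Matrix.transvection i j ξ
  inv := Matrix.transvection i j (-ξ)
  val_inv := by rw [Matrix.transvection_mul_transvection_same i j hij]; simp
  inv_val := by rw [Matrix.transvection_mul_transvection_same i j hij]; simp

variable (n R)

/-- The elementary group `E_n(R)`. -/
def elemGroup : Subgroup (Matrix.GeneralLinearGroup (Fin n) R) :=
  Subgroup.closure {x | ∃ (i j : Fin n) (hij : i ≠ j) (ξ : R), x = transv i j hij ξ}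

/-- `⋀²E_n(R)`, the image of the elementary group under the Cauchy–Binet homomorphism. -/
def extElemGroup : Subgroup (Matrix.GeneralLinearGroup (Pair n) R) :=
  (elemGroup n R).map extSq

/-- The group `⋀²GL_n(R)` (as a subset of `GL_N(R)`): the `R`-points of the scheme-theoretic image
of `⋀² : GL_n → GL_N`, where both are group schemes over `ℤ`. This image is the closed subscheme of
`GL_N` cut out by all integer polynomials in the matrix entries that vanish at `⋀²` of the generic
`n × n` matrix. (It suffices to test polynomials, without inverting determinants, since the
coordinate ring of `GL_n` is the localization of a domain at the determinant of the generic matrix,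
and the coordinate ring of `GL_N` is a localization of a polynomial ring.) It contains the image of
`⋀² : GL_n(R) → GL_N(R)`, but it is larger in general. -/
def extGL : Set (Matrix.GeneralLinearGroup (Pair n) R) :=
  {g | ∀ F : MvPolynomial (Pair n × Pair n) ℤ,
    MvPolynomial.aeval
      (fun p => minors (Matrix.mvPolynomialX (Fin n) (Fin n) ℤ) p.1 p.2) F = 0 →
    MvPolynomial.aeval (fun p => g.val p.1 p.2) F = 0}

variable {R}

/-- The full congruence subgroup of level `A`: the elements of `⋀²GL_n(R)` whose reduction modulo
`A` lies in the center of `⋀²GL_n(R/A)`. -/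
def fullCongruence (A : Ideal R) : Set (Matrix.GeneralLinearGroup (Pair n) R) :=
  {g | g ∈ extGL n R ∧
    Matrix.GeneralLinearGroup.map (Ideal.Quotient.mk A) g ∈
      extGL n (R ⧸ A) ∩ Set.centralizer (extGL n (R ⧸ A))}

variable {n}

/-- The upper level of `g`: the smallest ideal `A` such that `g` lies in the full congruence
subgroup of level `A`. -/
def upperLevel (g : Matrix.GeneralLinearGroup (Pair n) R) : Ideal R :=
  sInf {A : Ideal R | g ∈ fullCongruence n A}

/-- `y` is an elementary conjugate of `g` or of `g⁻¹`, that is, `y = h⁻¹ g h` or `y = h⁻¹ g⁻¹ h`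
for some `h` in `⋀²E_n(R)`. -/
def IsElemConj (g y : Matrix.GeneralLinearGroup (Pair n) R) : Prop :=
  ∃ h ∈ extElemGroup n R, y = h⁻¹ * g * h ∨ y = h⁻¹ * g⁻¹ * h

/-- `x` is a product of exactly `m` elementary conjugates of `g` and `g⁻¹`. -/
def IsProdElemConj (g : Matrix.GeneralLinearGroup (Pair n) R) (m : ℕ)
    (x : Matrix.GeneralLinearGroup (Pair n) R) : Prop :=
  ∃ L : List (Matrix.GeneralLinearGroup (Pair n) R),
    L.length = m ∧ (∀ y ∈ L, IsElemConj g y) ∧ L.prod = x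

end Minors

end ExtSq

namespace ExtSq

/-! ### Counting elementary conjugates. -/

section Products

variable {n : ℕ} {R : Type*} [CommRing R] {g : Matrix.GeneralLinearGroup (Pair n) R}

/-! The proof is a reverse decomposition of unipotents. Pretend `g = ⋀²x`. For `I ≠ J` pick `i ∈ I \
J` and a column `v`, supported on `i` and `J`, that the rows of `x` in `I` annihilate and with `v_i
= g_{I,J}`. With `T = ⋀²(e + v e_jᵀ)`, the preimage of `g T g⁻¹` has trivial row `i`. Hence
commuting `[T, g]` with `S = ⋀²t_{x,i}(1)` gives, up to conjugation by `T`, the product of `W = [S,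
T] = ⋀²t_{x,j}(g_{I,J})` and a factor that lives in column `i`. A last commutator with a conjugate
of `Z = ⋀²t_{j,i}(-ξ)` kills that factor and leaves `[Z, W] = ⋀²t_{x,i}(ξ g_{I,J})`
(`commutator_identity`). Three nested commutators cost `2³ = 8` conjugates
(`isProdElemConj_offDiag`).

In general `g` has no preimage `x`. But `v` is linear in the entries of `g`, and once inverses are
replaced by adjugates, the commutation used is an integer polynomial identity in these entries, so
it can be checked on the generic matrix (`aeval_eq_zero_of_mem_extGL`).

Diagonal differences at height one are off-diagonal entries of a conjugate of `g`, up to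
off-diagonal entries of `g`. These corrected differences also cost only `8`, and along a spanning
tree on the pairs they generate, together with the off-diagonal entries, an ideal containing the
level. -/

theorem IsElemConj.inv {y : Matrix.GeneralLinearGroup (Pair n) R} (hy : IsElemConj g y) :
    IsElemConj g y⁻¹ := by
  obtain ⟨h, hh, rfl | rfl⟩ := hy
  · exact ⟨h, hh, Or.inr (by group)⟩
  · exact ⟨h, hh, Or.inl (by group)⟩

theorem IsElemConj.conj {y h : Matrix.GeneralLinearGroup (Pair n) R} (hy : IsElemConj g y)
    (hh : h ∈ extElemGroup n R) : IsElemConj g (h * y * h⁻¹) := by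
  obtain ⟨k, hk, rfl | rfl⟩ := hy
  · exact ⟨k * h⁻¹, mul_mem hk (inv_mem hh), Or.inl (by group)⟩
  · exact ⟨k * h⁻¹, mul_mem hk (inv_mem hh), Or.inr (by group)⟩

theorem isProdElemConj_zero : IsProdElemConj g 0 1 := ⟨[], by simp⟩

theorem isProdElemConj_self : IsProdElemConj g 1 g :=
  ⟨[g], by simp, by simpa using ⟨1, one_mem _, Or.inl (by simp)⟩, by simp⟩

namespace IsProdElemConj

variable {m m' : ℕ} {x y h : Matrix.GeneralLinearGroup (Pair n) R}

theorem mul (hx : IsProdElemConj g m x) (hy : IsProdElemConj g m' y) :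
    IsProdElemConj g (m + m') (x * y) := by
  obtain ⟨L, rfl, hL, rfl⟩ := hx
  obtain ⟨L', rfl, hL', rfl⟩ := hy
  refine ⟨L ++ L', by simp, fun z hz => ?_, by simp⟩
  rcases List.mem_append.1 hz with hz | hz
  exacts [hL z hz, hL' z hz]

theorem inv (hx : IsProdElemConj g m x) : IsProdElemConj g m x⁻¹ := by
  obtain ⟨L, rfl, hL, rfl⟩ := hx
  refine ⟨(L.map (·⁻¹)).reverse, by simp, fun z hz => ?_, by rw [List.prod_inv_reverse]⟩
  simp only [List.mem_reverse, List.mem_map] at hz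
  obtain ⟨w, hw, rfl⟩ := hz
  exact (hL w hw).inv

theorem conj (hx : IsProdElemConj g m x) (hh : h ∈ extElemGroup n R) :
    IsProdElemConj g m (h * x * h⁻¹) := by
  obtain ⟨L, rfl, hL, rfl⟩ := hx
  refine ⟨L.map (MulAut.conj h), by simp, fun z hz => ?_, ?_⟩
  · obtain ⟨w, hw, rfl⟩ := List.mem_map.1 hz
    exact (hL w hw).conj hh
  · rw [← map_list_prod, MulAut.conj_apply]

/-- Each commutator with an elementary matrix doubles the count; this is the source of the constant
`8`. -/
theorem commutator (hx : IsProdElemConj g m x) (hh : h ∈ extElemGroup n R) :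
    IsProdElemConj g (m + m) (h * x * h⁻¹ * x⁻¹) :=
  (hx.conj hh).mul hx.inv

/-- Lengths are exact, so surplus length is filled with factors `g * g⁻¹`. -/
theorem add_two_mul (hx : IsProdElemConj g m x) (d : ℕ) : IsProdElemConj g (m + 2 * d) x := by
  induction d with
  | zero => exact hx
  | succ d ih => simpa [mul_add, ← add_assoc] using
      (ih.mul isProdElemConj_self).mul isProdElemConj_self.inv

theorem of_conj (hx : IsProdElemConj (h * g * h⁻¹) m x) (hh : h ∈ extElemGroup n R) :
    IsProdElemConj g m x := by
  obtain ⟨L, hm, hL, hp⟩ := hx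
  refine ⟨L, hm, fun y hy => ?_, hp⟩
  obtain ⟨k, hk, rfl | rfl⟩ := hL y hy
  · exact ⟨h⁻¹ * k, mul_mem (inv_mem hh) hk, Or.inl (by group)⟩
  · exact ⟨h⁻¹ * k, mul_mem (inv_mem hh) hk, Or.inr (by group)⟩

end IsProdElemConj

end Products

/-! ### Transvections, their relations and their exterior squares. -/

section Transvections

variable {n : ℕ} {R : Type*} [CommRing R]

theorem coe_extSq (x : Matrix.GeneralLinearGroup (Fin n) R) : (extSq x).val = minors x.val := rfl

theorem coe_transv (i j : Fin n) (hij : i ≠ j) (ξ : R) :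
    (transv i j hij ξ).val = Matrix.transvection i j ξ := rfl

theorem transv_mem (i j : Fin n) (hij : i ≠ j) (ξ : R) : transv i j hij ξ ∈ elemGroup n R :=
  Subgroup.subset_closure ⟨i, j, hij, ξ, rfl⟩

theorem extSq_mem {x : Matrix.GeneralLinearGroup (Fin n) R} (hx : x ∈ elemGroup n R) :
    extSq x ∈ extElemGroup n R :=
  Subgroup.mem_map_of_mem _ hx

theorem transv_mul (i j : Fin n) (hij : i ≠ j) (ξ ζ : R) :
    transv i j hij ξ * transv i j hij ζ = transv i j hij (ξ + ζ) :=
  Units.ext (Matrix.transvection_mul_transvection_same i j hij ξ ζ)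

theorem transv_inv (i j : Fin n) (hij : i ≠ j) (ξ : R) :
    (transv i j hij ξ)⁻¹ = transv i j hij (-ξ) := Units.ext rfl

theorem transv_conj_row {a b l : Fin n} (hab : a ≠ b) (hal : a ≠ l) (hbl : b ≠ l) (ξ : R) :
    (transv b a hab.symm (-1) * transv a b hab 1) * transv b l hbl ξ *
      (transv b a hab.symm (-1) * transv a b hab 1)⁻¹ = transv a l hal ξ := by
  rw [mul_inv_eq_iff_eq_mul]
  ext : 1
  simp only [Units.val_mul, coe_transv, Matrix.transvection]
  simp [mul_add, add_mul, hab, hal.symm, hbl.symm, ← Matrix.single_neg]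
  abel

theorem transv_conj_col {a b l : Fin n} (hab : a ≠ b) (hal : l ≠ a) (hbl : l ≠ b) (ξ : R) :
    (transv a b hab (-1) * transv b a hab.symm 1) * transv l b hbl ξ *
      (transv a b hab (-1) * transv b a hab.symm 1)⁻¹ = transv l a hal (-ξ) := by
  rw [mul_inv_eq_iff_eq_mul]
  ext : 1
  simp only [Units.val_mul, coe_transv, Matrix.transvection]
  simp [mul_add, add_mul, hab, hal.symm, hbl.symm, ← Matrix.single_neg]
  abel

theorem transv_commutator {a b c : Fin n} (hab : a ≠ b) (hbc : b ≠ c) (hac : a ≠ c) (ξ ζ : R) :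
    transv a b hab ξ * transv b c hbc ζ * (transv a b hab ξ)⁻¹ * (transv b c hbc ζ)⁻¹ =
      transv a c hac (ξ * ζ) := by
  rw [mul_inv_eq_iff_eq_mul, mul_inv_eq_iff_eq_mul]
  ext : 1
  simp only [Units.val_mul, coe_transv, Matrix.transvection]
  simp [mul_add, add_mul, hac.symm, hbc.symm]
  abel

/-- If all exterior transvections with parameter in `R s` at one position are products of `m`
elementary conjugates, then so are those at any other position. -/
theorem isProdElemConj_transv_of_transv {g : Matrix.GeneralLinearGroup (Pair n) R} (hn : 3 ≤ n)
    {m : ℕ} {s : R} {x i : Fin n} (hxi : x ≠ i)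
    (H : ∀ ξ : R, IsProdElemConj g m (extSq (transv x i hxi (ξ * s))))
    {k l : Fin n} (hkl : k ≠ l) (ξ : R) :
    IsProdElemConj g m (extSq (transv k l hkl (ξ * s))) := by
  have row : ∀ {b l : Fin n} (hbl : b ≠ l),
      (∀ ξ : R, IsProdElemConj g m (extSq (transv b l hbl (ξ * s)))) → ∀ {a : Fin n} (hal : a ≠ l)
      (ξ : R), IsProdElemConj g m (extSq (transv a l hal (ξ * s))) := by
    intro b l hbl h a hal ξ
    by_cases hab : a = b
    · subst hab; exact h ξ
    · rw [← transv_conj_row hab hal hbl, map_mul, map_mul _ (_ * _), map_inv]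
      exact (h ξ).conj (extSq_mem (mul_mem (transv_mem _ _ _ _) (transv_mem _ _ _ _)))
  have col : ∀ {l b : Fin n} (hbl : l ≠ b),
      (∀ ξ : R, IsProdElemConj g m (extSq (transv l b hbl (ξ * s)))) → ∀ {a : Fin n} (hal : l ≠ a)
      (ξ : R), IsProdElemConj g m (extSq (transv l a hal (ξ * s))) := by
    intro l b hbl h a hal ξ
    by_cases hab : a = b
    · subst hab; exact h ξ
    -- Moving the column changes the sign, which the free parameter absorbs.
    · have := (h (-ξ)).conj (extSq_mem (mul_mem (transv_mem a b hab (-1))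
        (transv_mem b a (Ne.symm hab) 1)))
      rw [← map_inv, ← map_mul, ← map_mul, transv_conj_col hab hal hbl] at this
      simpa using this
  -- If `k = i`, moving the row first would hit the diagonal, so the path goes through a third index
  -- `y`.
  by_cases hki : k = i
  · subst hki
    obtain ⟨y, hy⟩ := Finset.exists_mem_notMem_of_card_lt_card (s := {x, k}) (t := Finset.univ)
      (lt_of_le_of_lt Finset.card_le_two (by simp; omega))
    simp only [Finset.mem_univ, Finset.mem_insert, Finset.mem_singleton, not_or, true_and] at hy
    exact col (Ne.symm hy.2) (row (Ne.symm hy.1) (col hxi H (Ne.symm hy.1)) (Ne.symm hy.2)) hkl ξ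
  · exact col hki (row hxi H hki) hkl ξ

/-- A transvection differs from `e` by a matrix of rank at most one, whose second order minors
vanish; so no `ξ ^ 2` term survives. -/
theorem minors_transvection (i j : Fin n) (ξ : R) :
    minors (Matrix.transvection i j ξ) =
      1 + ξ • (minors (Matrix.transvection i j 1) - 1) := by
  rw [← minors_one]
  ext ⟨⟨a, b⟩, hab⟩ ⟨⟨c, d⟩, hcd⟩
  have hab' : a ≠ b := ne_of_lt hab
  have hcd' : c ≠ d := ne_of_lt hcd
  have key : Matrix.single i j (1 : R) a c * Matrix.single i j 1 b d = 0 ∧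
      Matrix.single i j (1 : R) a d * Matrix.single i j 1 b c = 0 := by
    constructor <;> simp only [Matrix.single_apply] <;> split_ifs <;> simp_all
  have hs : ∀ u v, Matrix.single i j ξ u v = ξ * Matrix.single i j (1 : R) u v := by
    intro u v; simp [Matrix.single_apply]
  simp only [minors, Matrix.of_apply, Matrix.transvection, Matrix.add_apply, Matrix.smul_apply,
    Matrix.sub_apply, smul_eq_mul]
  obtain ⟨h1, h2⟩ := key
  rw [hs a c, hs b d, hs a d, hs b c]
  linear_combination (ξ ^ 2 - ξ) * h1 - (ξ ^ 2 - ξ) * h2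

end Transvections

/-! ### Matrices with a trivial row. -/

section Stabilizer

variable {n : ℕ} {A : Type*} [CommRing A]

/-- If `b` has the same row `i` as the identity matrix, `[t_{x,i}, b]` lies in the abelian unipotent
radical attached to column `i`. -/
theorem commute_of_row_trivial {S : Type*} [Ring S] {E F b b' : S} (hbb : b * b' = 1)
    (hEb : E * b = E) (hEb' : E * b' = E) (hFb : F * b = F)
    (hEE : E * E = 0) (hEF : E * F = 0) (hFE : F * E = 0) :
    Commute (1 + F) ((1 + E) * b * (1 - E) * b') := by
  have h : (1 + E) * b * (1 - E) * b' = 1 + E - b * E := by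
    have : (1 + E) * b * (1 - E) * b' =
        b * b' - b * (E * b') + (E * b) * b' - (E * b) * (E * b') := by
      noncomm_ring
    rw [this, hEb', hbb, hEb, hEb', hEE, sub_zero]
    abel
  rw [h]
  have h1 : F * (b * E) = 0 := by rw [← mul_assoc, hFb, hFE]
  have h2 : b * E * F = 0 := by rw [mul_assoc, hEF, mul_zero]
  simp only [commute_iff_eq, mul_add, add_mul, mul_sub, sub_mul, one_mul, mul_one, hEF, hFE, h1, h2]
  abel

/-- The matrix `e + v e_jᵀ`. -/
def colMatrix (j : Fin n) (v : Fin n → A) : Matrix (Fin n) (Fin n) A :=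
  1 + Matrix.vecMulVec v (Pi.single j 1)

theorem colMatrix_mul {j : Fin n} {v w : Fin n → A} (hw : w j = 0) :
    colMatrix j v * colMatrix j w = colMatrix j (v + w) := by
  simp [colMatrix, mul_add, add_mul, Matrix.vecMulVec_mul_vecMulVec, hw, Matrix.add_vecMulVec]
  abel

theorem colMatrix_zero (j : Fin n) : colMatrix j (0 : Fin n → A) = 1 := by simp [colMatrix]

theorem colMatrix_single (i j : Fin n) (c : A) :
    colMatrix j (Pi.single i c) = Matrix.transvection i j c := by
  ext a b
  simp only [colMatrix, Matrix.transvection, Matrix.add_apply, Matrix.vecMulVec_apply,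
    Matrix.single_apply, Pi.single_apply]
  split_ifs <;> simp_all

/-- Conjugation by `a` turns `e ± v e_jᵀ` into `e ± (a v)(e_jᵀ a')`, and row `i` of the correction
vanishes with `(a v)_i`, whatever `a'` is. -/
theorem commute_transvection_of_row {a a' : Matrix (Fin n) (Fin n) A} (h : a * a' = 1)
    (h' : a' * a = 1) {v : Fin n → A} {i j x : Fin n} (hji : j ≠ i) (hxi : x ≠ i)
    (hrow : (a.mulVec v) i = 0) (hv : v j = 0) :
    Commute (Matrix.transvection j i (1 : A))
      (Matrix.transvection x i 1 * (a * colMatrix j (-v) * a') * Matrix.transvection x i (-1) *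
        (a * colMatrix j v * a')) := by
  have e : Matrix.transvection x i (-1 : A) = 1 - Matrix.single x i 1 := by
    rw [Matrix.transvection, ← Matrix.single_neg, sub_eq_add_neg]
  have key : ∀ (w : Fin n → A) (y : Fin n), (a.mulVec w) i = 0 →
      Matrix.single y i (1 : A) * (a * colMatrix j w * a') = Matrix.single y i 1 := by
    intro w y hw
    have h1 : a * colMatrix j w * a' = 1 + Matrix.vecMulVec (a.mulVec w)
        (Matrix.vecMul (Pi.single j 1) a') := by
      rw [colMatrix, mul_add, add_mul, mul_one, h, Matrix.mul_vecMulVec, Matrix.vecMulVec_mul]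
    have h2 : Matrix.single y i (1 : A) * Matrix.vecMulVec (a.mulVec w)
        (Matrix.vecMul (Pi.single j 1) a') = 0 := by
      rw [Matrix.mul_vecMulVec, Matrix.single_mulVec, hw]
      ext p q
      simp [Matrix.vecMulVec_apply]
    rw [h1, mul_add, h2, mul_one, add_zero]
  have hneg : (a.mulVec (-v)) i = 0 := by rw [Matrix.mulVec_neg, Pi.neg_apply, hrow, neg_zero]
  rw [e]
  refine commute_of_row_trivial ?_ (key _ _ hneg) (key _ _ hrow) (key _ _ hneg) ?_ ?_ ?_
  · calc a * colMatrix j (-v) * a' * (a * colMatrix j v * a')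
        = a * (colMatrix j (-v) * (a' * a) * colMatrix j v) * a' := by simp only [mul_assoc]
      _ = 1 := by rw [h', mul_one, colMatrix_mul hv, neg_add_cancel, colMatrix_zero, mul_one, h]
  all_goals simp [hxi.symm, hji.symm]

end Stabilizer

/-! ### Annihilated columns and reduction to the generic matrix. -/

section Generic

variable {n : ℕ} {A B : Type*} [CommRing A] [CommRing B]

/-- The entries of row `I` of a matrix with columns indexed by pairs, as an alternating function. -/
def altEntry (Y : Matrix (Pair n) (Pair n) A) (I : Pair n) (a b : Fin n) : A :=
  if h : a < b then Y I ⟨(a, b), h⟩ else if h : b < a then -Y I ⟨(b, a), h⟩ else 0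

theorem altEntry_minors (x : Matrix (Fin n) (Fin n) A) (I : Pair n) (a b : Fin n) :
    altEntry (minors x) I a b = x I.1.1 a * x I.1.2 b - x I.1.1 b * x I.1.2 a := by
  unfold altEntry
  split_ifs with h1 h2
  · simp [minors]
  · simp [minors]
  · obtain rfl : a = b := by omega
    ring

/-- A column supported on `i`, `q`, `r` that is annihilated by both rows of `x` in `I`, if
`Y = minors x`. -/
def annCol (Y : Matrix (Pair n) (Pair n) A) (I : Pair n) (i q r : Fin n) : Fin n → A :=
  Pi.single i (altEntry Y I q r) + Pi.single q (altEntry Y I r i) + Pi.single r (altEntry Y I i q)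

/-- Each value is the expansion of a `3 × 3` determinant on columns `i`, `q`, `r` with a repeated
row. -/
theorem mulVec_annCol (x : Matrix (Fin n) (Fin n) A) (I : Pair n) (i q r : Fin n) :
    (x.mulVec (annCol (minors x) I i q r)) I.1.1 = 0 ∧
      (x.mulVec (annCol (minors x) I i q r)) I.1.2 = 0 := by
  simp only [annCol, Matrix.mulVec_add, Pi.add_apply, Matrix.mulVec_single, altEntry_minors]
  constructor <;> simp [MulOpposite.smul_eq_mul_unop] <;> ring

theorem annCol_apply_of_ne (Y : Matrix (Pair n) (Pair n) A) (I : Pair n) {i q r j : Fin n}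
    (hi : j ≠ i) (hq : j ≠ q) (hr : j ≠ r) : annCol Y I i q r j = 0 := by
  simp [annCol, hi, hq, hr]

theorem map_minors (f : A →+* B) (x : Matrix (Fin n) (Fin n) A) :
    f.mapMatrix (minors x) = minors (f.mapMatrix x) := by
  ext I J; simp [minors]

theorem map_annCol (f : A →+* B) (Y : Matrix (Pair n) (Pair n) A) (I : Pair n) (i q r : Fin n) :
    f ∘ annCol Y I i q r = annCol (f.mapMatrix Y) I i q r := by
  have h : ∀ a b, f (altEntry Y I a b) = altEntry (f.mapMatrix Y) I a b := by
    intro a b; unfold altEntry; split_ifs <;> simp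
  ext a
  simp only [annCol, Function.comp, Pi.add_apply, map_add, Pi.single_apply, apply_ite f, h, map_zero]

theorem map_colMatrix (f : A →+* B) (j : Fin n) (v : Fin n → A) :
    f.mapMatrix (colMatrix j v) = colMatrix j (f ∘ v) := by
  ext a b
  simp [colMatrix, Matrix.one_apply, Matrix.vecMulVec_apply, Pi.single_apply, apply_ite f]

theorem map_transvection (f : A →+* B) (i j : Fin n) (c : A) :
    f.mapMatrix (Matrix.transvection i j c) = Matrix.transvection i j (f c) := by
  rw [← colMatrix_single, map_colMatrix, ← colMatrix_single]
  congr 1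
  ext a
  simp [Pi.single_apply, apply_ite f]

/-- The commutator of `⋀²t_{x,i}(1)` with `Y ⋀²(e - v e_jᵀ) Y⁻¹`, where `v = annCol Y I i q r`,
scaled by `(det Y)²`. -/
def scaledCommutator (I : Pair n) (i q r j x : Fin n) (Y : Matrix (Pair n) (Pair n) A) :
    Matrix (Pair n) (Pair n) A :=
  minors (Matrix.transvection x i 1) *
    (Y * minors (colMatrix j (-annCol Y I i q r)) * Y.adjugate) *
    minors (Matrix.transvection x i (-1)) *
    (Y * minors (colMatrix j (annCol Y I i q r)) * Y.adjugate)

theorem map_scaledCommutator (f : A →+* B) (I : Pair n) (i q r j x : Fin n)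
    (Y : Matrix (Pair n) (Pair n) A) :
    f.mapMatrix (scaledCommutator I i q r j x Y) =
      scaledCommutator I i q r j x (f.mapMatrix Y) := by
  have h : f ∘ (-annCol Y I i q r) = -(f ∘ annCol Y I i q r) := by ext; simp
  simp only [scaledCommutator, map_mul, map_minors, map_transvection, map_colMatrix, h, map_annCol,
    RingHom.map_adjugate, map_one, map_neg]

theorem adjugate_eq_det_smul {Y Y' : Matrix (Pair n) (Pair n) A} (h : Y * Y' = 1) :
    Y.adjugate = Y.det • Y' := by
  rw [← mul_one Y.adjugate, ← h, ← mul_assoc, Matrix.adjugate_mul, Matrix.smul_mul, one_mul]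

theorem scaledCommutator_eq {Y Y' : Matrix (Pair n) (Pair n) A} (h : Y * Y' = 1)
    (I : Pair n) (i q r j x : Fin n) :
    scaledCommutator I i q r j x Y = (Y.det * Y.det) • (minors (Matrix.transvection x i 1) *
      (Y * minors (colMatrix j (-annCol Y I i q r)) * Y') * minors (Matrix.transvection x i (-1)) *
      (Y * minors (colMatrix j (annCol Y I i q r)) * Y')) := by
  rw [scaledCommutator, adjugate_eq_det_smul h]
  simp only [Matrix.mul_smul, Matrix.smul_mul, smul_smul]

theorem commute_scaledCommutator_minors {a a' : Matrix (Fin n) (Fin n) A} (h : a * a' = 1)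
    (h' : a' * a = 1) {I : Pair n} {i q r j x : Fin n} (hi : i = I.1.1 ∨ i = I.1.2) (hxi : x ≠ i)
    (hji : j ≠ i) (hjq : j ≠ q) (hjr : j ≠ r) :
    Commute (minors (Matrix.transvection j i (1 : A)))
      (scaledCommutator I i q r j x (minors a)) := by
  rw [scaledCommutator_eq (Y' := minors a') (by rw [← minors_mul, h, minors_one])]
  apply Commute.smul_right
  simp only [commute_iff_eq, ← minors_mul]
  have hrow : (a.mulVec (annCol (minors a) I i q r)) i = 0 := by
    rcases hi with hi | hi
    · have := (mulVec_annCol a I i q r).1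
      rwa [← hi] at this
    · have := (mulVec_annCol a I i q r).2
      rwa [← hi] at this
  exact congrArg minors
    (commute_transvection_of_row h h' hji hxi hrow (annCol_apply_of_ne _ _ hji hjq hjr)).eq

theorem map_aeval_int {σ : Type*} (f : A →+* B) (y : σ → A) (F : MvPolynomial σ ℤ) :
    f (MvPolynomial.aeval y F) = MvPolynomial.aeval (fun p => f (y p)) F :=
  MvPolynomial.comp_aeval_apply y f.toIntAlgHom F

/-- A polynomial identity that holds for `⋀²` of all invertible matrices over fields holds
on `⋀²GL_n(R)`. -/
theorem aeval_eq_zero_of_mem_extGL {R : Type*} [CommRing R]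
    {g : Matrix.GeneralLinearGroup (Pair n) R} (hg : g ∈ extGL n R)
    (F : MvPolynomial (Pair n × Pair n) ℤ)
    (hF : ∀ (K : Type) [Field K] (a : Matrix (Fin n) (Fin n) K), IsUnit a.det →
      MvPolynomial.aeval (fun p => minors a p.1 p.2) F = 0) :
    MvPolynomial.aeval (fun p => g.val p.1 p.2) F = 0 := by
  apply hg
  let X := Matrix.mvPolynomialX (Fin n) (Fin n) ℤ
  -- The generic matrix is invertible over its field of fractions, and vanishing there implies
  -- vanishing over the polynomial ring.
  let K := FractionRing (MvPolynomial (Fin n × Fin n) ℤ)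
  let f : MvPolynomial (Fin n × Fin n) ℤ →+* K := algebraMap _ K
  have hf : Function.Injective f := IsFractionRing.injective _ _
  have hdet : IsUnit (f.mapMatrix X).det := by
    rw [← RingHom.map_det, isUnit_iff_ne_zero, map_ne_zero_iff f hf]
    exact Matrix.det_mvPolynomialX_ne_zero (Fin n) ℤ
  apply hf
  rw [map_zero, ← hF K _ hdet, ← map_minors]
  exact map_aeval_int f _ F

end Generic

/-! ### Extraction of off-diagonal entries. -/

section OffDiagonal

variable {n : ℕ} {R : Type*} [CommRing R] {g : Matrix.GeneralLinearGroup (Pair n) R}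

/-- The generic commutation defect of `scaledCommutator`. -/
def commDefect (I : Pair n) (i q r j x : Fin n) (Y : Matrix (Pair n) (Pair n) R) :
    Matrix (Pair n) (Pair n) R :=
  minors (Matrix.transvection j i 1) * scaledCommutator I i q r j x Y -
    scaledCommutator I i q r j x Y * minors (Matrix.transvection j i 1)

theorem aeval_commDefect (I : Pair n) (i q r j x : Fin n) (y : Matrix (Pair n) (Pair n) R)
    (K L : Pair n) :
    MvPolynomial.aeval (fun p => y p.1 p.2)
      (commDefect I i q r j x (Matrix.mvPolynomialX (Pair n) (Pair n) ℤ) K L) =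
        commDefect I i q r j x y K L := by
  let f := (MvPolynomial.aeval fun p => y p.1 p.2 :
    MvPolynomial (Pair n × Pair n) ℤ →ₐ[ℤ] R).toRingHom
  have hY : f.mapMatrix (Matrix.mvPolynomialX (Pair n) (Pair n) ℤ) = y := by
    ext K L; simp [f]
  have h : f.mapMatrix (commDefect I i q r j x (Matrix.mvPolynomialX (Pair n) (Pair n) ℤ)) =
      commDefect I i q r j x y := by
    simp only [commDefect, map_sub, map_mul, map_minors, map_transvection, map_scaledCommutator,
      hY, map_one]
  exact congrFun (congrFun h K) L

/-- With adjugates for inverses, the defect has integer polynomial entries, so the case of second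
order minors of invertible matrices over fields suffices. -/
theorem commute_scaledCommutator (hg : g ∈ extGL n R) {I : Pair n} {i q r j x : Fin n}
    (hi : i = I.1.1 ∨ i = I.1.2) (hxi : x ≠ i) (hji : j ≠ i) (hjq : j ≠ q) (hjr : j ≠ r) :
    Commute (minors (Matrix.transvection j i (1 : R))) (scaledCommutator I i q r j x g.val) := by
  rw [commute_iff_eq, ← sub_eq_zero]
  ext K L
  change commDefect I i q r j x g.val K L = 0
  rw [← aeval_commDefect]
  refine aeval_eq_zero_of_mem_extGL hg _ fun k _ a ha => ?_
  rw [aeval_commDefect, commDefect, (commute_scaledCommutator_minors (Matrix.mul_nonsing_inv a ha)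
    (Matrix.nonsing_inv_mul a ha) hi hxi hji hjq hjr).eq, sub_self]
  rfl

/-- The element `e + v e_jᵀ` of the elementary group, for a column `v` supported on
`i`, `q`, `r`. -/
theorem exists_elem_colMatrix {i q r j : Fin n} (hi : j ≠ i) (hq : j ≠ q) (hr : j ≠ r)
    (α β γ : R) : ∃ τ ∈ elemGroup n R,
      τ.val = colMatrix j (Pi.single i α + Pi.single q β + Pi.single r γ) := by
  refine ⟨transv i j hi.symm α * transv q j hq.symm β * transv r j hr.symm γ,
    mul_mem (mul_mem (transv_mem _ _ _ _) (transv_mem _ _ _ _)) (transv_mem _ _ _ _), ?_⟩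
  simp only [Units.val_mul, coe_transv, ← colMatrix_single]
  rw [colMatrix_mul, colMatrix_mul] <;> simp [hq, hr]

theorem inv_val_of_colMatrix {j : Fin n} {v : Fin n → R} (hv : v j = 0)
    {τ : Matrix.GeneralLinearGroup (Fin n) R} (hτ : τ.val = colMatrix j v) :
    (τ⁻¹).val = colMatrix j (-v) := by
  rw [← mul_one (τ⁻¹).val, ← colMatrix_zero j, ← add_neg_cancel v,
    ← colMatrix_mul (by simp [hv]), ← hτ, ← mul_assoc, ← Units.val_mul, inv_mul_cancel,
    Units.val_one, one_mul]

theorem commute_extSq_transv {C : Matrix.GeneralLinearGroup (Pair n) R} {j i : Fin n}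
    (hji : j ≠ i) (h : Commute (minors (Matrix.transvection j i (1 : R))) C.val) (ξ : R) :
    Commute (extSq (transv j i hji ξ)) C := by
  rw [commute_iff_eq]
  ext : 1
  rw [Units.val_mul, Units.val_mul, coe_extSq, coe_transv, minors_transvection]
  exact ((Commute.one_left _).add_left ((h.sub_left (Commute.one_left _)).smul_left ξ)).eq

/-- The commutator calculus behind the reverse decomposition. -/
theorem commutator_identity {G : Type*} [Group G] {T g S Z W : G}
    (hW : S * T * S⁻¹ * T⁻¹ = W) (hWT : Commute W T)
    (hZ : Commute Z (S * (g * T⁻¹ * g⁻¹) * S⁻¹ * (g * T * g⁻¹))) :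
    T⁻¹ * ((T * Z * T⁻¹) * (S * (T * g * T⁻¹ * g⁻¹) * S⁻¹ * (T * g * T⁻¹ * g⁻¹)⁻¹) *
      (T * Z * T⁻¹)⁻¹ * (S * (T * g * T⁻¹ * g⁻¹) * S⁻¹ * (T * g * T⁻¹ * g⁻¹)⁻¹)⁻¹) * T =
      Z * W * Z⁻¹ * W⁻¹ := by
  set u := S * (g * T⁻¹ * g⁻¹) * S⁻¹ * (g * T * g⁻¹) with hu
  have h1 : S * (T * g * T⁻¹ * g⁻¹) * S⁻¹ * (T * g * T⁻¹ * g⁻¹)⁻¹ = T * (W * u) * T⁻¹ := by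
    have hST : S * T = W * T * S := by rw [← hW]; group
    calc S * (T * g * T⁻¹ * g⁻¹) * S⁻¹ * (T * g * T⁻¹ * g⁻¹)⁻¹
        = (S * T) * (g * T⁻¹ * g⁻¹) * S⁻¹ * (g * T * g⁻¹) * T⁻¹ := by group
      _ = W * T * u * T⁻¹ := by rw [hST, hu]; group
      _ = T * (W * u) * T⁻¹ := by rw [hWT.eq]; group
  rw [h1]
  calc T⁻¹ * ((T * Z * T⁻¹) * (T * (W * u) * T⁻¹) * (T * Z * T⁻¹)⁻¹ * (T * (W * u) * T⁻¹)⁻¹) * T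
      = Z * W * (u * Z⁻¹) * u⁻¹ * W⁻¹ := by group
    _ = Z * W * Z⁻¹ * W⁻¹ := by rw [← (hZ.inv_left).eq]; group

/-- An off-diagonal entry of `g`, multiplied by any ring element, is extracted into a transvection
by `8` elementary conjugates of `g` and `g⁻¹`. -/
theorem isProdElemConj_offDiag (hn : 4 ≤ n) (hg : g ∈ extGL n R) {I J : Pair n} (hIJ : I ≠ J)
    {k l : Fin n} (hkl : k ≠ l) (ξ : R) :
    IsProdElemConj g 8 (extSq (transv k l hkl (ξ * g.val I J))) := by
  obtain ⟨i, hi, hiq, hir⟩ : ∃ i, (i = I.1.1 ∨ i = I.1.2) ∧ i ≠ J.1.1 ∧ i ≠ J.1.2 := by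
    by_contra! H
    have h1 := H _ (Or.inl rfl)
    have h2 := H _ (Or.inr rfl)
    have hI := I.2
    have hJ := J.2
    apply hIJ
    ext <;> omega
  -- An index outside the support of `v` needs `4 ≤ n`.
  obtain ⟨j, -, hj⟩ := Finset.exists_mem_notMem_of_card_lt_card (s := {i, J.1.1, J.1.2})
    (t := Finset.univ) (lt_of_le_of_lt Finset.card_le_three (by simp; omega))
  obtain ⟨x, -, hx⟩ := Finset.exists_mem_notMem_of_card_lt_card (s := {i, j})
    (t := Finset.univ) (lt_of_le_of_lt Finset.card_le_two (by simp; omega))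
  simp only [Finset.mem_insert, Finset.mem_singleton, not_or] at hj hx
  obtain ⟨hji, hjq, hjr⟩ := hj
  obtain ⟨hxi, hxj⟩ := hx
  refine isProdElemConj_transv_of_transv (by omega) hxi (fun ξ => ?_) hkl ξ
  set v := annCol g.val I i J.1.1 J.1.2 with hv
  have hvj : v j = 0 := annCol_apply_of_ne _ _ hji hjq hjr
  have hvi : v i = g.val I J := by simp [hv, annCol, hiq, hir, altEntry, J.2]
  obtain ⟨τ, hτ, hτv⟩ : ∃ τ ∈ elemGroup n R, τ.val = colMatrix j v :=
    exists_elem_colMatrix hji hjq hjr _ _ _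
  have hτi := inv_val_of_colMatrix hvj hτv
  have hW : transv x i hxi 1 * τ * (transv x i hxi 1)⁻¹ * τ⁻¹ = transv x j hxj (g.val I J) := by
    rw [mul_inv_eq_iff_eq_mul, mul_inv_eq_iff_eq_mul]
    ext : 1
    simp only [Units.val_mul, hτv, coe_transv, ← colMatrix_single, ← hvi]
    rw [colMatrix_mul hvj]
    have hs : (Pi.single x (v i) : Fin n → R) = v i • Pi.single x 1 := by
      rw [← Pi.single_smul, smul_eq_mul, mul_one]
    simp [colMatrix, mul_add, add_mul, Matrix.vecMulVec_mul_vecMulVec, Matrix.add_vecMulVec, hs, hxj,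
      Matrix.smul_vecMulVec]
    abel
  have hWT : Commute (transv x j hxj (g.val I J)) τ := by
    rw [commute_iff_eq]
    ext : 1
    simp only [Units.val_mul, hτv, coe_transv, ← colMatrix_single]
    rw [colMatrix_mul hvj, colMatrix_mul (by simp [Ne.symm hxj]), add_comm]
  set T := extSq τ with hT
  set S := extSq (transv x i hxi (1 : R)) with hS
  have hZ : ∀ ξ, Commute (extSq (transv j i hji ξ))
      (S * (g * T⁻¹ * g⁻¹) * S⁻¹ * (g * T * g⁻¹)) := by
    refine commute_extSq_transv hji ?_
    have h := commute_scaledCommutator hg hi hxi hji hjq hjr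
    rw [scaledCommutator_eq (Y' := (g⁻¹).val) (by rw [← Units.val_mul]; simp), ← hv, ← hτv, ← hτi]
      at h
    -- The two adjugates contributed `(det g)²`, a unit, which is now divided out.
    have hdet : IsUnit (g.val.det * g.val.det) :=
      (Matrix.isUnits_det_units g).mul (Matrix.isUnits_det_units g)
    obtain ⟨d, hd⟩ := hdet
    rw [← hd] at h
    have h2 := h.smul_right (↑d⁻¹ : R)
    rw [smul_smul, Units.inv_mul, one_smul] at h2
    simpa only [Units.val_mul, hS, hT, ← map_inv, transv_inv, coe_extSq, coe_transv] using h2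
  have hTmem : T ∈ extElemGroup n R := extSq_mem hτ
  have hSmem : S ∈ extElemGroup n R := extSq_mem (transv_mem _ _ _ _)
  have hZmem : extSq (transv j i hji (-ξ)) ∈ extElemGroup n R := extSq_mem (transv_mem _ _ _ _)
  have key := ((((isProdElemConj_self (g := g)).commutator hTmem).commutator hSmem).commutator
    (mul_mem (mul_mem hTmem hZmem) (inv_mem hTmem))).conj (inv_mem hTmem)
  rw [inv_inv, commutator_identity (W := extSq (transv x j hxj (g.val I J)))
    (by rw [← hW]; simp only [map_mul, map_inv, hS]) (hWT.map extSq) (hZ _)] at key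
  have hfin : transv x i hxi (ξ * g.val I J) =
      (transv j i hji (-ξ)) * transv x j hxj (g.val I J) * (transv j i hji (-ξ))⁻¹ *
        (transv x j hxj (g.val I J))⁻¹ := by
    have h := transv_commutator hxj hji hxi (g.val I J) (-ξ)
    apply inv_injective
    rw [transv_inv, show -(ξ * g.val I J) = g.val I J * -ξ by ring, ← h]
    group
  rw [hfin]
  simpa only [map_mul, map_inv] using key

end OffDiagonal

/-! ### Differences of diagonal entries. -/

section Diagonal

variable {n : ℕ} {R : Type*} [CommRing R] {g : Matrix.GeneralLinearGroup (Pair n) R}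

theorem aeval_minors_eq_zero {F : MvPolynomial (Pair n × Pair n) ℤ}
    (hF : MvPolynomial.aeval
      (fun p => minors (Matrix.mvPolynomialX (Fin n) (Fin n) ℤ) p.1 p.2) F = 0)
    (a : Matrix (Fin n) (Fin n) R) : MvPolynomial.aeval (fun p => minors a p.1 p.2) F = 0 := by
  let f := (MvPolynomial.aeval fun p => a p.1 p.2 :
    MvPolynomial (Fin n × Fin n) ℤ →ₐ[ℤ] R).toRingHom
  have ha : f.mapMatrix (Matrix.mvPolynomialX (Fin n) (Fin n) ℤ) = a := by ext; simp [f]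
  rw [← ha, ← map_minors, ← map_zero f, ← hF]
  exact (map_aeval_int f _ F).symm

theorem aeval_aeval_conj (i j : Fin n) (F : MvPolynomial (Pair n × Pair n) ℤ)
    (y : Matrix (Pair n) (Pair n) R) :
    MvPolynomial.aeval (fun p : Pair n × Pair n => y p.1 p.2)
      (MvPolynomial.aeval (fun p : Pair n × Pair n => (minors (Matrix.transvection i j 1) *
        Matrix.mvPolynomialX (Pair n) (Pair n) ℤ * minors (Matrix.transvection i j (-1)) :
          Matrix (Pair n) (Pair n) (MvPolynomial (Pair n × Pair n) ℤ)) p.1 p.2) F) =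
    MvPolynomial.aeval (fun p : Pair n × Pair n => (minors (Matrix.transvection i j 1) * y *
      minors (Matrix.transvection i j (-1)) : Matrix (Pair n) (Pair n) R) p.1 p.2) F := by
  let f := (MvPolynomial.aeval fun p => y p.1 p.2 :
    MvPolynomial (Pair n × Pair n) ℤ →ₐ[ℤ] R).toRingHom
  have hY : f.mapMatrix (Matrix.mvPolynomialX (Pair n) (Pair n) ℤ) = y := by ext; simp [f]
  have h : f.mapMatrix (minors (Matrix.transvection i j 1) *
      Matrix.mvPolynomialX (Pair n) (Pair n) ℤ * minors (Matrix.transvection i j (-1))) =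
      minors (Matrix.transvection i j 1) * y * minors (Matrix.transvection i j (-1)) := by
    simp only [map_mul, map_minors, map_transvection, hY, map_one, map_neg]
  rw [← h]
  exact map_aeval_int f _ F

/-- Conjugation is a polynomial substitution carrying `⋀²` of the generic matrix to `⋀²` of its
conjugate, so it preserves the defining equations. -/
theorem conj_mem_extGL (hg : g ∈ extGL n R) (i j : Fin n) (hij : i ≠ j) :
    extSq (transv i j hij 1) * g * (extSq (transv i j hij 1))⁻¹ ∈ extGL n R := by
  intro F hF
  refine (aeval_aeval_conj i j F g.val).symm.trans (hg _ ((aeval_aeval_conj i j F _).trans ?_))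
  simp only [← minors_mul]
  exact aeval_minors_eq_zero hF _

theorem height_eq_one_cases {I J : Pair n} (h : height I J = 1) :
    (I.1.1 = J.1.1 ∧ I.1.2 ≠ J.1.2) ∨ (I.1.2 = J.1.2 ∧ I.1.1 ≠ J.1.1) ∨ I.1.2 = J.1.1 ∨
      I.1.1 = J.1.2 := by
  obtain ⟨⟨a, b⟩, hab⟩ := I
  obtain ⟨⟨c, d⟩, hcd⟩ := J
  simp only [height] at h ⊢
  simp only at hab
  by_contra! H
  obtain ⟨h1, h2, h3, h4⟩ := H
  by_cases hac : a = c
  · obtain rfl := hac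
    obtain rfl := h1 rfl
    rw [Finset.inter_self, Finset.card_pair hab.ne] at h
    omega
  · have hbd : b ≠ d := fun hbd => hac (h2 hbd)
    rw [Finset.disjoint_iff_inter_eq_empty.1] at h
    · simp at h
    · simp [Ne.symm hac, Ne.symm hbd, Ne.symm h3, Ne.symm h4]

/-- Take `i ∈ I \ J` and `j ∈ J \ I`; `ε` is the sign of sorting after `i` is replaced by `j` in
`I`. -/
theorem exists_transvection_of_height_eq_one {I J : Pair n} (h : height I J = 1) :
    ∃ i j : Fin n, i ≠ j ∧ ∃ ε : R, ε * ε = 1 ∧ ∀ c : R,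
      (∀ K, minors (Matrix.transvection i j c) I K =
        (if K = I then 1 else 0) + if K = J then c * ε else 0) ∧
      (∀ K, minors (Matrix.transvection i j c) K J =
        (if K = J then 1 else 0) + if K = I then c * ε else 0) := by
  have hcases := height_eq_one_cases h
  clear h
  obtain ⟨⟨a, b⟩, hab⟩ := I
  obtain ⟨⟨c, d⟩, hcd⟩ := J
  simp only at hab hcd hcases
  have row : ∀ {i p : Fin n} (j q : Fin n) (c : R), p ≠ i → Matrix.transvection i j c p q =
      if q = p then 1 else 0 := by
    intro i p j q c hp
    simp [Matrix.transvection, Matrix.one_apply, eq_comm, hp.symm]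
  have row' : ∀ (i j q : Fin n) (c : R), Matrix.transvection i j c i q =
      (if q = i then 1 else 0) + if q = j then c else 0 := by
    intro i j q c
    simp [Matrix.transvection, Matrix.one_apply, Matrix.single_apply, eq_comm]
  have col : ∀ {j q : Fin n} (i p : Fin n) (c : R), q ≠ j → Matrix.transvection i j c p q =
      if p = q then 1 else 0 := by
    intro j q i p c hq
    simp [Matrix.transvection, Matrix.one_apply, hq.symm]
  have col' : ∀ (i j p : Fin n) (c : R), Matrix.transvection i j c p j =
      (if p = j then 1 else 0) + if p = i then c else 0 := by
    intro i j p c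
    simp [Matrix.transvection, Matrix.one_apply, Matrix.single_apply, eq_comm]
  rcases hcases with ⟨rfl, hbd⟩ | ⟨rfl, hac⟩ | rfl | rfl
  · refine ⟨b, d, hbd, 1, by simp, fun ξ => ⟨?_, ?_⟩⟩ <;> rintro ⟨⟨k, l⟩, hkl⟩ <;>
      simp only [minors, Matrix.of_apply, Subtype.mk.injEq, Prod.mk.injEq, row', col',
        row d _ ξ hab.ne, col b _ ξ hcd.ne] <;> simp only at hkl
    all_goals grind
  · refine ⟨a, c, hac, 1, by simp, fun ξ => ⟨?_, ?_⟩⟩ <;> rintro ⟨⟨k, l⟩, hkl⟩ <;>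
      simp only [minors, Matrix.of_apply, Subtype.mk.injEq, Prod.mk.injEq, row', col',
        row c _ ξ hab.ne', col a _ ξ hcd.ne'] <;> simp only at hkl
    all_goals grind
  · refine ⟨a, d, by omega, -1, by simp, fun ξ => ⟨?_, ?_⟩⟩ <;> rintro ⟨⟨k, l⟩, hkl⟩ <;>
      simp only [minors, Matrix.of_apply, Subtype.mk.injEq, Prod.mk.injEq, row', col',
        row d _ ξ hab.ne', col a _ ξ hcd.ne] <;> simp only at hkl
    all_goals grind
  · refine ⟨b, c, by omega, -1, by simp, fun ξ => ⟨?_, ?_⟩⟩ <;> rintro ⟨⟨k, l⟩, hkl⟩ <;>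
      simp only [minors, Matrix.of_apply, Subtype.mk.injEq, Prod.mk.injEq, row', col',
        row c _ ξ hab.ne, col b _ ξ hcd.ne'] <;> simp only at hkl
    all_goals grind

theorem ne_of_height_lt_two {I J : Pair n} (h : height I J < 2) : I ≠ J := by
  rintro rfl
  rw [height, Finset.inter_self, Finset.card_pair I.2.ne] at h
  omega

/-- A diagonal difference at height one becomes an off-diagonal entry of a conjugate, up to
off-diagonal entries of `g`. -/
theorem exists_isProdElemConj_of_height_eq_one (hn : 4 ≤ n) (hg : g ∈ extGL n R) {I J : Pair n}
    (h : height I J = 1) : ∃ ε : R, ε * ε = 1 ∧ ∀ (k l : Fin n) (hkl : k ≠ l) (ξ : R),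
      IsProdElemConj g 8 (extSq (transv k l hkl
        (ξ * (g.val I I - g.val J J - ε * g.val I J + ε * g.val J I)))) := by
  obtain ⟨i, j, hij, ε, hε, hT⟩ := exists_transvection_of_height_eq_one (R := R) h
  have hIJ := ne_of_height_lt_two (h.trans_lt one_lt_two)
  refine ⟨ε, hε, fun k l hkl ξ => ?_⟩
  -- The entry at `(I, J)` of the conjugate contains `-ε (g_{I,I} - g_{J,J})`; the factor `-ε`
  -- removes this sign.
  have key := (isProdElemConj_offDiag hn (conj_mem_extGL hg i j hij) hIJ hkl (-ε * ξ)).of_conj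
    (extSq_mem (transv_mem _ _ _ _))
  have hent : (extSq (transv i j hij 1) * g * (extSq (transv i j hij 1))⁻¹).val I J =
      g.val I J - ε * g.val I I + ε * g.val J J - g.val J I := by
    rw [← map_inv, transv_inv, Units.val_mul, Units.val_mul, coe_extSq, coe_extSq, coe_transv,
      coe_transv, mul_assoc, Matrix.mul_apply]
    simp only [(hT 1).1, Matrix.mul_apply, (hT (-1)).2, mul_add, add_mul, Finset.sum_add_distrib,
      ite_mul, mul_ite, mul_one, one_mul, mul_zero, zero_mul, Finset.sum_ite_eq',
      Finset.mem_univ, if_true]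
    linear_combination (-g.val J I) * hε
  rw [hent] at key
  convert key using 3
  linear_combination (-ξ * (g.val I I - g.val J J)) * hε

theorem isProdElemConj_transv_add {m m' : ℕ} {k l : Fin n} {hkl : k ≠ l} {a b : R}
    (ha : IsProdElemConj g m (extSq (transv k l hkl a)))
    (hb : IsProdElemConj g m' (extSq (transv k l hkl b))) :
    IsProdElemConj g (m + m') (extSq (transv k l hkl (a + b))) := by
  rw [← transv_mul, map_mul]
  exact ha.mul hb

theorem isProdElemConj_diag_sub (hn : 4 ≤ n) (hg : g ∈ extGL n R) {I J : Pair n}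
    (h : height I J = 1) {k l : Fin n} (hkl : k ≠ l) :
    IsProdElemConj g 24 (extSq (transv k l hkl (g.val I I - g.val J J))) := by
  obtain ⟨ε, -, H⟩ := exists_isProdElemConj_of_height_eq_one hn hg h
  have hIJ := ne_of_height_lt_two (h.trans_lt one_lt_two)
  have key := isProdElemConj_transv_add (isProdElemConj_transv_add (H k l hkl 1)
    (isProdElemConj_offDiag hn hg hIJ hkl ε)) (isProdElemConj_offDiag hn hg hIJ.symm hkl (-ε))
  convert key using 3
  ring

theorem exists_height_eq_one_of_height_eq_zero {I J : Pair n} (h : height I J = 0) :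
    ∃ K, height I K = 1 ∧ height K J = 1 := by
  obtain ⟨⟨a, b⟩, hab⟩ := I
  obtain ⟨⟨c, d⟩, hcd⟩ := J
  simp only [height, Finset.card_eq_zero, ← Finset.disjoint_iff_inter_eq_empty,
    Finset.disjoint_insert_left, Finset.disjoint_singleton_left, Finset.mem_insert,
    Finset.mem_singleton, not_or] at h
  simp only at hab hcd
  obtain ⟨⟨h1, h2⟩, h3, h4⟩ := h
  have hI : ({a, b} : Finset (Fin n)) ∩ {a, c} = {a} := by ext; simp; omega
  have hJ : ({a, c} : Finset (Fin n)) ∩ {c, d} = {c} := by ext; simp; omega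
  rcases lt_or_gt_of_ne h1 with hac | hac
  · exact ⟨⟨(a, c), hac⟩, by simp [height, hI], by simp [height, hJ]⟩
  · exact ⟨⟨(c, a), hac⟩, by simp [height, Finset.pair_comm c a, hI],
      by simp [height, Finset.pair_comm c a, hJ]⟩

end Diagonal

/-! ### Generators of an ideal containing the upper level. -/

section Level

variable {n : ℕ} {R : Type*} [CommRing R] {g : Matrix.GeneralLinearGroup (Pair n) R}

theorem map_mem_extGL {S : Type*} [CommRing S] (f : R →+* S) (hg : g ∈ extGL n R) :
    Matrix.GeneralLinearGroup.map f g ∈ extGL n S := by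
  intro F hF
  have h := congrArg f (hg F hF)
  rwa [map_aeval_int, map_zero] at h

/-- A matrix that is scalar modulo `A` has upper level contained in `A`. -/
theorem upperLevel_le (hg : g ∈ extGL n R) {A : Ideal R} (h : ∀ I J, I ≠ J → g.val I J ∈ A)
    (h' : ∀ I J, g.val I I - g.val J J ∈ A) : upperLevel g ≤ A := by
  refine sInf_le ⟨hg, map_mem_extGL _ hg, fun x _ => ?_⟩
  ext K L
  have hd : ∀ I J, I ≠ J → (Matrix.GeneralLinearGroup.map (Ideal.Quotient.mk A) g).val I J = 0 :=
    fun I J hIJ => Ideal.Quotient.eq_zero_iff_mem.2 (h I J hIJ)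
  rw [Units.val_mul, Units.val_mul, Matrix.mul_apply, Matrix.mul_apply,
    Finset.sum_eq_single L (fun M _ hM => by rw [hd M L hM, mul_zero]) (by simp),
    Finset.sum_eq_single K (fun M _ hM => by rw [hd K M hM.symm, zero_mul]) (by simp), mul_comm]
  congr 1
  exact Ideal.Quotient.eq.2 (h' L K)

theorem isProdElemConj_of_mem_span {ι : Type*} {k l : Fin n} {hkl : k ≠ l} {m : ℕ}
    (s : Finset ι) (y : ι → R)
    (H : ∀ p ∈ s, ∀ ξ, IsProdElemConj g m (extSq (transv k l hkl (ξ * y p)))) {ξ : R}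
    (hξ : ξ ∈ Ideal.span (y '' s)) :
    IsProdElemConj g (m * s.card) (extSq (transv k l hkl ξ)) := by
  classical
  obtain ⟨c, rfl⟩ := (Submodule.mem_span_image_finset_iff_exists_fun' R).1 hξ
  clear hξ
  induction s using Finset.induction_on with
  | empty =>
    have h : transv k l hkl (0 : R) = 1 := Units.ext (by simp [coe_transv])
    simpa [h] using isProdElemConj_zero
  | insert p s hp ih =>
    rw [Finset.sum_insert hp, Finset.card_insert_of_notMem hp, mul_add, mul_one, add_comm (m * _)]
    exact isProdElemConj_transv_add (H p (by simp) (c p)) (ih fun q hq => H q (by simp [hq]))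

/-- Applying `sum_pair` to the indicator of `a ≠ b` counts every pair twice. -/
theorem card_pair (n : ℕ) : Fintype.card (Pair n) = n.choose 2 := by
  have h := sum_pair (n := n) (fun a b => if a = b then (0 : ℤ) else 1) (by simp)
  have h1 : ∀ K : Pair n, K.1.1 ≠ K.1.2 := fun K => K.2.ne
  have h2 : ∀ a : Fin n, ∑ b, (if a = b then (0 : ℤ) else 1) = n - 1 := by
    intro a
    have : ∀ b, (if a = b then (0 : ℤ) else 1) = 1 - if a = b then 1 else 0 := by
      intro b; split_ifs <;> simp
    simp [this]
  simp only [h2, h1, (h1 _).symm, if_false, Finset.sum_const, Finset.card_univ, Fintype.card_fin,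
    nsmul_eq_mul] at h
  rw [Nat.choose_two_right]
  rcases n with _ | n
  · simp
  · push_cast at h
    have h' : (n + 1) * n = Fintype.card (Pair (n + 1)) * 2 := by zify; linarith
    rw [Nat.add_sub_cancel, h', Nat.mul_div_cancel _ two_pos]

theorem height_eq_zero_or_one {I J : Pair n} (h : I ≠ J) : height I J = 0 ∨ height I J = 1 := by
  have h2 : height I J ≤ 2 := (Finset.card_le_card Finset.inter_subset_left).trans
    Finset.card_le_two
  have h3 : height I J ≠ 2 := by
    intro h3
    have hI : ({I.1.1, I.1.2} : Finset (Fin n)) ∩ {J.1.1, J.1.2} = {I.1.1, I.1.2} :=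
      Finset.eq_of_subset_of_card_le Finset.inter_subset_left
        (by rw [Finset.card_pair I.2.ne]; exact h3.ge)
    rw [Finset.inter_eq_left] at hI
    have h4 : I.1.1 = J.1.1 ∨ I.1.1 = J.1.2 := by simpa using hI (by simp : I.1.1 ∈ _)
    have h5 : I.1.2 = J.1.1 ∨ I.1.2 = J.1.2 := by simpa using hI (by simp : I.1.2 ∈ _)
    have hI := I.2
    have hJ := J.2
    apply h
    ext <;> omega
  omega

/-- Transvections with parameter in the upper level: it is generated modulo one diagonal position by
`N² - 1` elements, each of which costs `8` elementary conjugates. -/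
theorem isProdElemConj_of_mem_upperLevel (hn : 4 ≤ n) (hg : g ∈ extGL n R) {k l : Fin n}
    (hkl : k ≠ l) {ξ : R} (hξ : ξ ∈ upperLevel g) :
    IsProdElemConj g (8 * ((n.choose 2) ^ 2 - 1)) (extSq (transv k l hkl ξ)) := by
  -- `O` is the root of a tree of depth at most two; `P I` is the parent of `I`, at height one from
  -- it, and equals `O` when `I` has height one to `O`.
  let O : Pair n := ⟨(⟨0, by omega⟩, ⟨1, by omega⟩), by simp⟩
  have hP : ∀ I : Pair n, ∃ P : Pair n, ∃ ε : R, I ≠ O → ((height I O = 1 → P = O) ∧ (P = O ∨ height P O = 1) ∧ I ≠ P ∧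
      ∀ (k l : Fin n) (hkl : k ≠ l) (ξ : R), IsProdElemConj g 8 (extSq (transv k l hkl
        (ξ * (g.val I I - g.val P P - ε * g.val I P + ε * g.val P I))))) := by
    intro I
    by_cases hI : I = O
    · exact ⟨O, 0, fun h => absurd hI h⟩
    obtain ⟨P, hP, hP', hIP⟩ : ∃ P, (height I O = 1 → P = O) ∧ (P = O ∨ height P O = 1) ∧
        height I P = 1 := by
      rcases height_eq_zero_or_one hI with h | h
      · obtain ⟨P, h1, h2⟩ := exists_height_eq_one_of_height_eq_zero h
        exact ⟨P, fun h' => by omega, Or.inr h2, h1⟩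
      · exact ⟨O, fun _ => rfl, Or.inl rfl, h⟩
    obtain ⟨ε, -, H⟩ := exists_isProdElemConj_of_height_eq_one hn hg hIP
    exact ⟨P, ε, fun _ => ⟨hP, hP', ne_of_height_lt_two (hIP.trans_lt one_lt_two), H⟩⟩
  choose P ε hP using hP
  -- Position `(I, I)` stores the corrected difference along the edge from `I` to its parent, which
  -- costs `8`, not `24`. The root has no edge, so `(O, O)` is dropped: hence `N² - 1`.
  let y : Pair n × Pair n → R := fun p => if p.1 = p.2 then
    g.val p.1 p.1 - g.val (P p.1) (P p.1) - ε p.1 * g.val p.1 (P p.1) + ε p.1 * g.val (P p.1) p.1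
    else g.val p.1 p.2
  let s : Finset (Pair n × Pair n) := Finset.univ.erase (O, O)
  have hs : s.card = (n.choose 2) ^ 2 - 1 := by
    rw [Finset.card_erase_of_mem (Finset.mem_univ _), Finset.card_univ, Fintype.card_prod,
      card_pair, sq]
  rw [← hs]
  refine isProdElemConj_of_mem_span s y ?_ ?_
  · rintro ⟨I, J⟩ hIJ ζ
    by_cases h : I = J
    · subst h
      have hI : I ≠ O := by rintro rfl; simp [s] at hIJ
      simpa [y] using (hP I hI).2.2.2 k l hkl ζ
    · simpa [y, h] using isProdElemConj_offDiag hn hg h hkl ζ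
  · have hy : ∀ p ∈ s, y p ∈ Ideal.span (y '' s) := fun p hp =>
      Ideal.subset_span (Set.mem_image_of_mem y (Finset.mem_coe.2 hp))
    have hoff : ∀ I J, I ≠ J → g.val I J ∈ Ideal.span (y '' s) := by
      intro I J hIJ
      have h := hy (I, J) (Finset.mem_erase.2 ⟨fun h => hIJ ((congrArg Prod.fst h).trans
        (congrArg Prod.snd h).symm), Finset.mem_univ _⟩)
      simpa [y, hIJ] using h
    have hstep : ∀ I, I ≠ O → g.val I I - g.val (P I) (P I) ∈ Ideal.span (y '' s) := by
      intro I hI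
      have h := hy (I, I) (by simp [s, hI])
      have hIP := (hP I hI).2.2.1
      simp only [y, if_true] at h
      have := add_mem (sub_mem h (Ideal.mul_mem_left _ (ε I) (hoff _ _ hIP.symm)))
        (Ideal.mul_mem_left _ (ε I) (hoff _ _ hIP))
      convert this using 1
      ring
    have hone : ∀ I, I = O ∨ height I O = 1 → g.val I I - g.val O O ∈ Ideal.span (y '' s) := by
      intro I hI
      by_cases h : I = O
      · rw [h, sub_self]; exact zero_mem _
      · have h' := hstep I h
        rwa [(hP I h).1 (hI.resolve_left h)] at h'
    have hroot : ∀ I, g.val I I - g.val O O ∈ Ideal.span (y '' s) := by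
      intro I
      by_cases h : I = O
      · exact hone I (Or.inl h)
      · have := add_mem (hstep I h) (hone _ (hP I h).2.1)
        rwa [sub_add_sub_cancel] at this
    refine upperLevel_le hg hoff (fun I J => ?_) hξ
    have := sub_mem (hroot I) (hroot J)
    rwa [sub_sub_sub_cancel_right] at this

end Level

end ExtSq

theorem theorem1 {R : Type*} [CommRing R] (n : ℕ) (hn : 4 ≤ n)
    (g : Matrix.GeneralLinearGroup (ExtSq.Pair n) R) (hg : g ∈ ExtSq.extGL n R)
    (k l : Fin n) (hkl : k ≠ l) :
    (∀ ξ ∈ ExtSq.upperLevel g, ∃ m ≤ 8 * ((n.choose 2) ^ 2 - 1),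
      ExtSq.IsProdElemConj g m (ExtSq.extSq (ExtSq.transv k l hkl ξ))) ∧
    (∀ I J : ExtSq.Pair n, ExtSq.height I J = 1 →
      ExtSq.IsProdElemConj g 8 (ExtSq.extSq (ExtSq.transv k l hkl (g.val I J)))) ∧
    (∀ I J : ExtSq.Pair n, ExtSq.height I J = 0 →
      ExtSq.IsProdElemConj g 16 (ExtSq.extSq (ExtSq.transv k l hkl (g.val I J)))) ∧
    (∀ I J : ExtSq.Pair n, ExtSq.height I J = 1 →
      ExtSq.IsProdElemConj g 24
        (ExtSq.extSq (ExtSq.transv k l hkl (g.val I I - g.val J J)))) ∧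
    (∀ I J : ExtSq.Pair n, ExtSq.height I J = 0 →
      ExtSq.IsProdElemConj g 48
        (ExtSq.extSq (ExtSq.transv k l hkl (g.val I I - g.val J J)))) := by
  refine ⟨fun ξ hξ => ⟨_, le_rfl, ExtSq.isProdElemConj_of_mem_upperLevel hn hg hkl hξ⟩,
    ?_, ?_, ?_, ?_⟩
  · intro I J h
    simpa using ExtSq.isProdElemConj_offDiag hn hg (ExtSq.ne_of_height_lt_two (by omega)) hkl 1
  · intro I J h
    -- Eight conjugates already suffice here; four pairs `g * g⁻¹` bring the length to `16`.
    simpa using (ExtSq.isProdElemConj_offDiag hn hg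
      (ExtSq.ne_of_height_lt_two (by omega)) hkl 1).add_two_mul 4
  · intro I J h
    exact ExtSq.isProdElemConj_diag_sub hn hg h hkl
  · intro I J h
    obtain ⟨K, hIK, hKJ⟩ := ExtSq.exists_height_eq_one_of_height_eq_zero h
    simpa using ExtSq.isProdElemConj_transv_add (ExtSq.isProdElemConj_diag_sub hn hg hIK hkl)
      (ExtSq.isProdElemConj_diag_sub hn hg hKJ hkl)
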